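/- Let $d\ge 3$ and let $$\mathcal D=\Big\{x\in\mathbb R^d:\ \sum_{p=0}^{n-1}\Big(\sum_{l=1+d_p}^{d_{p+1}}x_l^{\omega_l}\Big)^{m_{p+1}}\le 1\Big\},$$ where $n,m_1,\dots,m_n$ are positive integers, $0=d_0<d_1<\dots<d_n=d$ are integers, and $\omega_1,\dots,\omega_d$ are even positive integers. For $1\le i\le d$ let $p(i)$ be the unique $p\in\{0,\dots,n-1\}$ with $1+d_p\le i\le d_{p+1}$, and for $1\le j,l\le d$ put $m_{j,l}=1$ if $p(j)=p(l)$ and $m_{j,l}=m_{p(l)+1}$ if $p(j)\ne p(l)$. For $x\in\partial\mathcal D$ let $T_x$ be the affine tangent plane to $\partial\mathcal D$ at $x$, and for $\delta>0$ put $\tilde B(x,\delta)=\{y\in\partial\mathcal D:\operatorname{dist}(y,T_x)<\delta\}$. Let $\sigma$ be the surface measure on $\partial\mathcal D$. Let $0<\varepsilon_0\le 1$. There is a constant $C>0$, depending only on $\varepsilon_0$ and $\mathcal D$ (that is, on $d,n,(d_p),(m_p),(\omega_l)$), such that for every $1\le j\le d$ and every nonzero $\xi\in\mathbb R^d$ with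 $|\xi_j|/|\xi|\ge\varepsilon_0$, there is a unique point $x(\xi)\in\partial\mathcal D$ at which the unit exterior normal is $\xi/|\xi|$, and $$\sigma\big(\tilde B(x(\xi),|\xi|^{-1})\big)\le C\prod_{\substack{1\le l\le d\\ l\ne j}}\min\Big\{|\xi|^{-\frac1{m_{j,l}\omega_l}},\ |\xi|^{-\frac12}\Big(\frac{|\xi_l|}{|\xi|}\Big)^{-\frac{m_{j,l}\omega_l-2}{2(m_{j,l}\omega_l-1)}}\Big\}.$$ Here a negative power of $0$ is read as $+\infty$, and $0^0=1$. -/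

import Mathlib

open MeasureTheory
open scoped ENNReal Gradient InnerProductSpace

/-- The data of a model domain in `ℝ^d`: cuts `0 = d_0 < d_1 < ⋯ < d_n = d`, which split the
coordinates into `n` consecutive blocks, an outer exponent `m_{p+1} ≥ 1` for each block
`p = 0, …, n-1`, and an even positive inner exponent `ω_l` for each coordinate. The coordinates
are numbered `0, …, d-1`. -/
structure ModelData (d : ℕ) where
  n : ℕ
  cut : Fin (n + 1) → ℕ
  m : Fin n → ℕ
  ω : Fin d → ℕ
  cut_zero : cut 0 = 0
  cut_last : cut (Fin.last n) = d
  cut_strictMono : StrictMono cut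
  m_pos : ∀ p, 0 < m p
  ω_pos : ∀ l, 0 < ω l
  ω_even : ∀ l, Even (ω l)

namespace ModelData

variable {d : ℕ} (M : ModelData d)

/-- The coordinates of block `p`: in the numbering that starts with `0`, they are the `l` with
`d_p ≤ l < d_{p+1}`. -/
def block (p : Fin M.n) : Finset (Fin d) :=
  Finset.univ.filter fun l => M.cut p.castSucc ≤ (l : ℕ) ∧ (l : ℕ) < M.cut p.succ

theorem existsUnique_block (i : Fin d) : ∃! p : Fin M.n, i ∈ M.block p := by
  have key : ∀ k : Fin (M.n + 1), (i : ℕ) < M.cut k → ∃ p : Fin M.n, i ∈ M.block p := by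
    intro k
    induction k using Fin.induction with
    | zero => intro h; rw [M.cut_zero] at h; exact absurd h (Nat.not_lt_zero _)
    | succ p ih =>
      intro h
      by_cases h' : (i : ℕ) < M.cut p.castSucc
      · exact ih h'
      · exact ⟨p, by simpa [block] using ⟨not_lt.mp h', h⟩⟩
  obtain ⟨p, hp⟩ := key (Fin.last M.n) (by rw [M.cut_last]; exact i.isLt)
  refine ⟨p, hp, fun q hq => ?_⟩
  simp only [block, Finset.mem_filter, Finset.mem_univ, true_and] at hp hq
  have h1 := M.cut_strictMono.lt_iff_lt.mp (lt_of_le_of_lt hp.1 hq.2)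
  have h2 := M.cut_strictMono.lt_iff_lt.mp (lt_of_le_of_lt hq.1 hp.2)
  rw [Fin.lt_def] at h1 h2
  simp only [Fin.val_castSucc, Fin.val_succ] at h1 h2
  exact Fin.ext (by omega)

/-- `p(i)`: the index of the unique block that contains the coordinate `i`. -/
noncomputable def blockIndex (i : Fin d) : Fin M.n :=
  (M.existsUnique_block i).choose

/-- `m_{j,l}`: it is `1` if `p(j) = p(l)`, and the outer exponent of the block of `l` otherwise. -/
noncomputable def mm (j l : Fin d) : ℕ :=
  if M.blockIndex j = M.blockIndex l then 1 else M.m (M.blockIndex l)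

/-- The defining function `F(x) = ∑_p (∑_{l in block p} x_l^{ω_l})^{m_{p+1}}`. -/
noncomputable def F (x : EuclideanSpace ℝ (Fin d)) : ℝ :=
  ∑ p : Fin M.n, (∑ l ∈ M.block p, x l ^ M.ω l) ^ M.m p

/-- The domain `𝒟 = {F ≤ 1}`; its boundary is the topological boundary `frontier 𝒟`. -/
def domain : Set (EuclideanSpace ℝ (Fin d)) :=
  {x | M.F x ≤ 1}

/-- The unit exterior normal of the sublevel set `{F ≤ 1}` at a boundary point: the normalized
gradient of the defining function. -/
noncomputable def exteriorNormal (x : EuclideanSpace ℝ (Fin d)) : EuclideanSpace ℝ (Fin d) :=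
  ‖∇ M.F x‖⁻¹ • ∇ M.F x

/-- The affine tangent plane `T_x` of the boundary at a boundary point `x`: the hyperplane through
`x` orthogonal to the normal. -/
def tangentPlane (x : EuclideanSpace ℝ (Fin d)) : Set (EuclideanSpace ℝ (Fin d)) :=
  {y | ⟪M.exteriorNormal x, y - x⟫_ℝ = 0}

/-- The cap `B̃(x, δ) = {y ∈ ∂𝒟 : dist(y, T_x) < δ}`. -/
def cap (x : EuclideanSpace ℝ (Fin d)) (δ : ℝ) : Set (EuclideanSpace ℝ (Fin d)) :=
  {y | y ∈ frontier M.domain ∧ Metric.infDist y (M.tangentPlane x) < δ}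

/-- `x` is a point of `∂𝒟` at which the unit exterior normal is `ξ / |ξ|`. -/
def IsPointWithNormal (ξ x : EuclideanSpace ℝ (Fin d)) : Prop :=
  x ∈ frontier M.domain ∧ M.exteriorNormal x = ‖ξ‖⁻¹ • ξ

/-- The surface measure `σ` on `∂𝒟`: the `(d-1)`-dimensional Hausdorff measure, in the
normalization that gives the unit cube of `ℝ^{d-1}` measure `1`, restricted to `∂𝒟`. -/
noncomputable def surfaceMeasure : Measure (EuclideanSpace ℝ (Fin d)) :=
  (Measure.euclideanHausdorffMeasure (d - 1)).restrict (frontier M.domain)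

/-- With `k = m_{j,l} ω_l`, the factor
`min {|ξ|^{-1/k}, |ξ|^{-1/2} (|ξ_l|/|ξ|)^{-(k-2)/(2(k-1))}}`, computed in `[0, ∞]`:
a negative power of `0` is `∞`, and `0 ^ 0 = 1`. -/
noncomputable def factor (ξ : EuclideanSpace ℝ (Fin d)) (j l : Fin d) : ℝ≥0∞ :=
  let k : ℝ := (M.mm j l : ℝ) * (M.ω l : ℝ)
  min (ENNReal.ofReal ‖ξ‖ ^ (-(1 / k)))
    (ENNReal.ofReal ‖ξ‖ ^ (-(1 / 2) : ℝ) *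
      ENNReal.ofReal (|ξ l| / ‖ξ‖) ^ (-((k - 2) / (2 * (k - 1)))))

end ModelData

/-! The proof rests on the convexity defect D(y, x) = F(y) - F(x) - ⟨∇F(x), y - x⟩, called
`bregman`. It is a sum of nonnegative block terms. For x, y ∈ ∂𝒟 it equals |∇F(x)| dist(y, T_x), so
on a cap of height δ = |ξ|⁻¹ it is at most a constant times δ (`bregman_le_of_mem_cap`).

Let S be the inner sum of the block of l at x, k = m_{j,l} ω_l, t = |y_l - x_l| and η = |ξ_l|/|ξ|.
The condition |ξ_j| ≥ ε₀|ξ| keeps the outer derivative of the block of j away from 0, so in that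
block the inner defect alone gives the bounds; this is why m_{j,l} = 1 there. Hence D dominates both
t^k and W t², where W = S^(m_{j,l}-1) |x_l|^(ω_l-2) (`increment_le_bregman`). The first bound gives
t ≲ δ^(1/k). For the second, η ≲ W|x_l| and |x_l|^(k-2) ≤ W imply η^(k-2) ≲ W^(k-1), so η^(k-2)
t^(2(k-1)) ≲ δ^(k-1) (`exists_cap_extent`). These are the two terms of the minimum, and the cap lies
in the corresponding box.

For large |ξ| the cap is so small that ∂_j F keeps its sign and size on it. By convexity it is then
a Lipschitz graph over the other coordinates, and its area is at most a multiple of the product of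
the box sides. For bounded |ξ| it suffices that ∂𝒟 has finite area and that the factors are bounded
below. The point x(ξ) is a maximizer of ⟨ξ, ·⟩ on 𝒟; strict convexity makes it unique. -/

/-! ### Convexity defects of powers in one variable -/

/-- The remainder of the tangent line of `s ↦ s ^ m` at `a ≥ 0` dominates the `m`-th power of the
increment. -/
theorem sub_pow_le_pow_sub_tangent {a b : ℝ} (ha : 0 ≤ a) (hab : a ≤ b) {m : ℕ} (hm : 2 ≤ m) :
    (b - a) ^ m ≤ b ^ m - a ^ m - m * a ^ (m - 1) * (b - a) := by
  induction m, hm using Nat.le_induction with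
  | base => norm_num; nlinarith
  | succ k hk ih =>
    obtain ⟨h, rfl⟩ : ∃ h, b = a + h := ⟨b - a, by ring⟩
    have hh : 0 ≤ h := by linarith
    obtain ⟨k, rfl⟩ : ∃ i, k = i + 1 := ⟨k - 1, by omega⟩
    simp only [add_sub_cancel_left, Nat.add_sub_cancel] at ih ⊢
    have h1 : h * h ^ (k + 1) ≤
        (a + h) * ((a + h) ^ (k + 1) - a ^ (k + 1) - ((k + 1 : ℕ) : ℝ) * a ^ k * h) :=
      mul_le_mul (by linarith) ih (by positivity) (by linarith)
    have h2 : 0 ≤ ((k + 1 : ℕ) : ℝ) * a ^ k * h ^ 2 := by positivity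
    push_cast at h1 h2 ⊢
    have e : (a + h) ^ (k + 1 + 1) - a ^ (k + 1 + 1) - (↑k + 1 + 1) * a ^ (k + 1) * h =
      (a + h) * ((a + h) ^ (k + 1) - a ^ (k + 1) - (↑k + 1) * a ^ k * h)
        + (↑k + 1) * a ^ k * h ^ 2 := by ring
    rw [e, pow_succ' h]
    linarith

/-- The remainders R_m satisfy R_{m+1} = b R_m + m a^(m-1) (b - a)², which drives the induction. -/
theorem pow_sub_tangent_nonneg {a b : ℝ} (ha : 0 ≤ a) (hb : 0 ≤ b) {m : ℕ} (hm : 0 < m) :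
    0 ≤ b ^ m - a ^ m - m * a ^ (m - 1) * (b - a) := by
  induction m, hm using Nat.le_induction with
  | base => simp
  | succ k hk ih =>
    obtain ⟨k, rfl⟩ : ∃ i, k = i + 1 := ⟨k - 1, by omega⟩
    simp only [Nat.add_sub_cancel] at ih ⊢
    have h1 := mul_nonneg hb ih
    have h2 : 0 ≤ ((k + 1 : ℕ) : ℝ) * a ^ k * (b - a) ^ 2 := by positivity
    have e : b ^ (k + 1 + 1) - a ^ (k + 1 + 1) - ((k + 1 + 1 : ℕ) : ℝ) * a ^ (k + 1) * (b - a) =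
      b * (b ^ (k + 1) - a ^ (k + 1) - ((k + 1 : ℕ) : ℝ) * a ^ k * (b - a))
        + ((k + 1 : ℕ) : ℝ) * a ^ k * (b - a) ^ 2 := by push_cast; ring
    rw [e]
    linarith

/-- A lower bound for the convexity defect of an `m`-th power of a function whose value goes from
`a` to `b` and whose own convexity defect is `B`. -/
theorem pow_defect_lower_bound {a b B c t : ℝ} {w m : ℕ} (hm : 0 < m) (ha : 0 ≤ a) (hb : 0 ≤ b)
    (hc : 0 < c) (hc1 : c ≤ 1) (ht : 0 ≤ t) (hB : c * t ^ w ≤ B) (hw : 0 < w)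
    (hab : a < (t / 3) ^ w → (2 * (t / 3)) ^ w ≤ b) :
    c * (t / 3) ^ (w * m) ≤ b ^ m - a ^ m - m * a ^ (m - 1) * (b - a) + m * a ^ (m - 1) * B := by
  have hT := pow_sub_tangent_nonneg ha hb hm
  have hu : 0 ≤ t / 3 := by positivity
  have hut : (t / 3) ^ w ≤ t ^ w := pow_le_pow_left₀ hu (by linarith) w
  have hBu : c * (t / 3) ^ w ≤ B := le_trans (by gcongr) hB
  have hB0 : 0 ≤ B := le_trans (by positivity) hBu
  -- If a is at least (t/3)^w, the outer derivative times B is large enough. Otherwise b is at least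
  -- twice (t/3)^w, and the tangent remainder of the outer power takes over, except for m = 1, where
  -- the defect is B itself.
  rcases le_or_gt ((t / 3) ^ w) a with h | h
  · have h1 : c * (t / 3) ^ (w * m) ≤ a ^ (m - 1) * B := by
      obtain ⟨k, rfl⟩ : ∃ i, m = i + 1 := ⟨m - 1, by omega⟩
      have : ((t / 3) ^ w) ^ k * (c * (t / 3) ^ w) ≤ a ^ k * B := by gcongr
      calc _ = ((t / 3) ^ w) ^ k * (c * (t / 3) ^ w) := by rw [pow_mul]; ring
        _ ≤ _ := this
    have h2 : a ^ (m - 1) * B ≤ m * a ^ (m - 1) * B := by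
      have : (1 : ℝ) ≤ m := by exact_mod_cast hm
      have h3 : 0 ≤ a ^ (m - 1) * B := by positivity
      nlinarith
    linarith
  · rcases Nat.lt_or_ge m 2 with h2 | h2
    · obtain rfl : m = 1 := by omega
      simp
      linarith
    · have hb' := hab h
      rw [mul_pow] at hb'
      have h2w : (2 : ℝ) ≤ 2 ^ w := by
        calc (2 : ℝ) = 2 ^ 1 := by norm_num
          _ ≤ 2 ^ w := pow_le_pow_right₀ (by norm_num) hw
      have hgap : (t / 3) ^ w ≤ b - a := by
        have : 2 * (t / 3) ^ w ≤ 2 ^ w * (t / 3) ^ w := by gcongr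
        linarith
      have hgap0 : 0 ≤ (t / 3) ^ w := by positivity
      have h3 := sub_pow_le_pow_sub_tangent ha (by linarith : a ≤ b) h2
      have h4 : ((t / 3) ^ w) ^ m ≤ (b - a) ^ m := pow_le_pow_left₀ hgap0 hgap m
      have h5 : c * (t / 3) ^ (w * m) ≤ ((t / 3) ^ w) ^ m := by
        rw [← pow_mul]
        exact mul_le_of_le_one_left (by positivity) hc1
      have h6 : 0 ≤ m * a ^ (m - 1) * B := by positivity
      linarith

/-- The convexity defect of `s ↦ s ^ w` between `x` and `y`. -/
def powBregman (w : ℕ) (y x : ℝ) : ℝ := y ^ w - x ^ w - w * x ^ (w - 1) * (y - x)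

/-- Writing s^(2r) = (s²)^r splits the defect into the remainder of the outer power and the outer
derivative times the defect (y - x)² of the square. This is the same shape as a block term of F, so
one lower bound serves both. -/
theorem powBregman_eq_of_two_mul (r : ℕ) (hr : 0 < r) (y x : ℝ) :
    powBregman (2 * r) y x = (y ^ 2) ^ r - (x ^ 2) ^ r - r * (x ^ 2) ^ (r - 1) * (y ^ 2 - x ^ 2)
      + r * (x ^ 2) ^ (r - 1) * (y - x) ^ 2 := by
  obtain ⟨k, rfl⟩ : ∃ i, r = i + 1 := ⟨r - 1, by omega⟩
  have : 2 * (k + 1) - 1 = 2 * k + 1 := by omega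
  simp only [powBregman, this, Nat.add_sub_cancel, ← pow_mul]
  push_cast
  ring

theorem powBregman_ge_sq {w : ℕ} (hw : Even w) (hw0 : 0 < w) (y x : ℝ) :
    |x| ^ (w - 2) * |y - x| ^ 2 ≤ powBregman w y x := by
  obtain ⟨r, rfl⟩ := even_iff_two_dvd.mp hw
  have hr : 0 < r := by omega
  rw [powBregman_eq_of_two_mul r hr]
  have h := pow_sub_tangent_nonneg (sq_nonneg x) (sq_nonneg y) hr
  have e : |x| ^ (2 * r - 2) = (x ^ 2) ^ (r - 1) := by
    rw [show 2 * r - 2 = 2 * (r - 1) by omega, pow_mul, sq_abs]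
  rw [e, sq_abs]
  have h1 : (1 : ℝ) ≤ r := by exact_mod_cast hr
  have h2 : 0 ≤ (x ^ 2) ^ (r - 1) * (y - x) ^ 2 := by positivity
  nlinarith

theorem powBregman_nonneg {w : ℕ} (hw : Even w) (hw0 : 0 < w) (y x : ℝ) :
    0 ≤ powBregman w y x :=
  le_trans (by positivity) (powBregman_ge_sq hw hw0 y x)

/-- If |x| is below a third of |y - x|, then |y| exceeds two thirds of it by the triangle
inequality. -/
theorem pow_le_of_lt_third_pow {w : ℕ} (hw : Even w) {x y a : ℝ} (hxa : x ^ w ≤ a)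
    (ha : a < (|y - x| / 3) ^ w) : (2 * (|y - x| / 3)) ^ w ≤ y ^ w := by
  have h1 : |x| < |y - x| / 3 := by
    rw [← hw.pow_abs] at hxa
    exact lt_of_pow_lt_pow_left₀ w (by positivity) (hxa.trans_lt ha)
  have h2 : |y - x| ≤ |y| + |x| := abs_sub y x
  rw [← hw.pow_abs y]
  exact pow_le_pow_left₀ (by positivity) (by linarith) w

theorem powBregman_ge_pow {w : ℕ} (hw : Even w) (hw0 : 0 < w) (y x : ℝ) :
    (|y - x| / 3) ^ w ≤ powBregman w y x := by
  obtain ⟨r, rfl⟩ := even_iff_two_dvd.mp hw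
  have hr : 0 < r := by omega
  rw [powBregman_eq_of_two_mul r hr]
  have := pow_defect_lower_bound (a := x ^ 2) (b := y ^ 2) (B := (y - x) ^ 2) (c := 1)
    (t := |y - x|) (w := 2) hr (sq_nonneg x) (sq_nonneg y) one_pos le_rfl (abs_nonneg _)
    (by rw [one_mul, sq_abs]) two_pos (fun h => pow_le_of_lt_third_pow even_two le_rfl h)
  simpa using this

/-! ### The gradient and the convexity defect of F -/

namespace ModelData

variable {d : ℕ} (M : ModelData d)

theorem mem_block_blockIndex (i : Fin d) : i ∈ M.block (M.blockIndex i) :=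
  (M.existsUnique_block i).choose_spec.1

theorem mem_block_iff {i : Fin d} {p : Fin M.n} : i ∈ M.block p ↔ M.blockIndex i = p :=
  ⟨fun h => ((M.existsUnique_block i).unique h (M.mem_block_blockIndex i)).symm,
    fun h => h ▸ M.mem_block_blockIndex i⟩

theorem sum_block_sum (f : Fin d → ℝ) : ∑ p : Fin M.n, ∑ l ∈ M.block p, f l = ∑ l, f l := by
  have h : ∀ p, M.block p = Finset.univ.filter fun l => M.blockIndex l = p := fun p => by
    ext l; simp [mem_block_iff]
  simp only [h]
  exact Finset.sum_fiberwise _ _ _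

/-- The inner sum `∑_{l in block p} x_l^{ω_l}`. -/
noncomputable def blockSum (p : Fin M.n) (x : EuclideanSpace ℝ (Fin d)) : ℝ :=
  ∑ l ∈ M.block p, x l ^ M.ω l

theorem blockSum_nonneg (p : Fin M.n) (x : EuclideanSpace ℝ (Fin d)) : 0 ≤ M.blockSum p x :=
  Finset.sum_nonneg fun l _ => (M.ω_even l).pow_nonneg _

theorem pow_le_blockSum (l : Fin d) (x : EuclideanSpace ℝ (Fin d)) :
    x l ^ M.ω l ≤ M.blockSum (M.blockIndex l) x :=
  Finset.single_le_sum (f := fun l => x l ^ M.ω l) (fun l _ => (M.ω_even l).pow_nonneg _)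
    (M.mem_block_blockIndex l)

theorem F_eq (x : EuclideanSpace ℝ (Fin d)) : M.F x = ∑ p, M.blockSum p x ^ M.m p := rfl

/-- The gradient of the defining function, in coordinates. -/
noncomputable def grad (x : EuclideanSpace ℝ (Fin d)) : EuclideanSpace ℝ (Fin d) :=
  WithLp.toLp 2 fun l => M.m (M.blockIndex l) * M.blockSum (M.blockIndex l) x ^
    (M.m (M.blockIndex l) - 1) * (M.ω l * x l ^ (M.ω l - 1))

theorem grad_apply (x : EuclideanSpace ℝ (Fin d)) (l : Fin d) :
    M.grad x l = M.m (M.blockIndex l) * M.blockSum (M.blockIndex l) x ^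
      (M.m (M.blockIndex l) - 1) * (M.ω l * x l ^ (M.ω l - 1)) := rfl

theorem inner_grad (x v : EuclideanSpace ℝ (Fin d)) :
    ⟪M.grad x, v⟫_ℝ = ∑ p, M.m p * M.blockSum p x ^ (M.m p - 1) *
      ∑ l ∈ M.block p, M.ω l * x l ^ (M.ω l - 1) * v l := by
  rw [PiLp.inner_apply, ← M.sum_block_sum]
  refine Finset.sum_congr rfl fun p _ => ?_
  rw [Finset.mul_sum]
  refine Finset.sum_congr rfl fun l hl => ?_
  obtain rfl := M.mem_block_iff.mp hl
  simp [grad_apply]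
  ring

theorem hasStrictFDerivAt_F (x : EuclideanSpace ℝ (Fin d)) :
    HasStrictFDerivAt M.F (InnerProductSpace.toDual ℝ _ (M.grad x)) x := by
  have h1 : ∀ l : Fin d, HasStrictFDerivAt (fun x : EuclideanSpace ℝ (Fin d) => x l)
      (EuclideanSpace.proj l : EuclideanSpace ℝ (Fin d) →L[ℝ] ℝ) x := fun l =>
    (EuclideanSpace.proj l : EuclideanSpace ℝ (Fin d) →L[ℝ] ℝ).hasStrictFDerivAt
  have h2 : HasStrictFDerivAt M.F _ x := HasStrictFDerivAt.fun_sum (u := Finset.univ) fun p _ =>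
    (HasStrictFDerivAt.fun_sum (u := M.block p) fun l _ => (h1 l).pow (M.ω l)).pow (M.m p)
  refine h2.congr_fderiv ?_
  ext v
  rw [InnerProductSpace.toDual_apply_apply, inner_grad]
  simp [blockSum, Finset.mul_sum, mul_assoc]

theorem gradient_F (x : EuclideanSpace ℝ (Fin d)) : ∇ M.F x = M.grad x :=
  HasGradientAt.gradient (M.hasStrictFDerivAt_F x).hasFDerivAt

theorem continuous_F : Continuous M.F :=
  continuous_iff_continuousAt.mpr fun x => (M.hasStrictFDerivAt_F x).continuousAt

theorem continuous_grad : Continuous M.grad := by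
  unfold grad blockSum
  fun_prop

/-- The convexity defect `F y - F x - ⟨∇F x, y - x⟩`. -/
noncomputable def bregman (y x : EuclideanSpace ℝ (Fin d)) : ℝ :=
  M.F y - M.F x - ⟪M.grad x, y - x⟫_ℝ

/-- The contribution of block `p` to the convexity defect. -/
noncomputable def blockBregman (p : Fin M.n) (y x : EuclideanSpace ℝ (Fin d)) : ℝ :=
  M.blockSum p y ^ M.m p - M.blockSum p x ^ M.m p
    - M.m p * M.blockSum p x ^ (M.m p - 1) * (M.blockSum p y - M.blockSum p x)
    + M.m p * M.blockSum p x ^ (M.m p - 1) * ∑ l ∈ M.block p, powBregman (M.ω l) (y l) (x l)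

/-- In each block the linear term is the increment of the inner sum minus the inner defects;
multiplied by the outer derivative, this gives `blockBregman`. -/
theorem bregman_eq (y x : EuclideanSpace ℝ (Fin d)) :
    M.bregman y x = ∑ p, M.blockBregman p y x := by
  rw [bregman, F_eq, F_eq, inner_grad, ← Finset.sum_sub_distrib, ← Finset.sum_sub_distrib]
  refine Finset.sum_congr rfl fun p _ => ?_
  simp only [blockBregman, powBregman, Finset.sum_sub_distrib, ← blockSum.eq_def, PiLp.sub_apply]
  ring

theorem sum_powBregman_nonneg (p : Fin M.n) (y x : EuclideanSpace ℝ (Fin d)) :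
    0 ≤ ∑ l ∈ M.block p, powBregman (M.ω l) (y l) (x l) :=
  Finset.sum_nonneg fun l _ => powBregman_nonneg (M.ω_even l) (M.ω_pos l) _ _

theorem powBregman_le_sum (l : Fin d) (y x : EuclideanSpace ℝ (Fin d)) :
    powBregman (M.ω l) (y l) (x l) ≤
      ∑ l ∈ M.block (M.blockIndex l), powBregman (M.ω l) (y l) (x l) :=
  Finset.single_le_sum (f := fun l => powBregman (M.ω l) (y l) (x l))
    (fun l _ => powBregman_nonneg (M.ω_even l) (M.ω_pos l) _ _) (M.mem_block_blockIndex l)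

theorem blockBregman_nonneg (p : Fin M.n) (y x : EuclideanSpace ℝ (Fin d)) :
    0 ≤ M.blockBregman p y x := by
  have h1 := pow_sub_tangent_nonneg (M.blockSum_nonneg p x) (M.blockSum_nonneg p y) (M.m_pos p)
  have h2 := M.sum_powBregman_nonneg p y x
  have h3 := M.blockSum_nonneg p x
  exact add_nonneg h1 (by positivity)

theorem bregman_nonneg (y x : EuclideanSpace ℝ (Fin d)) : 0 ≤ M.bregman y x := by
  rw [bregman_eq]
  exact Finset.sum_nonneg fun p _ => M.blockBregman_nonneg p y x

theorem blockBregman_le (p : Fin M.n) (y x : EuclideanSpace ℝ (Fin d)) :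
    M.blockBregman p y x ≤ M.bregman y x := by
  rw [bregman_eq]
  exact Finset.single_le_sum (f := fun p => M.blockBregman p y x)
    (fun p _ => M.blockBregman_nonneg p y x) (Finset.mem_univ p)

theorem blockSum_pow_mul_powBregman_le (l : Fin d) (y x : EuclideanSpace ℝ (Fin d)) :
    M.blockSum (M.blockIndex l) x ^ (M.m (M.blockIndex l) - 1) * powBregman (M.ω l) (y l) (x l) ≤
      M.bregman y x := by
  refine le_trans ?_ (M.blockBregman_le (M.blockIndex l) y x)
  have h1 := pow_sub_tangent_nonneg (M.blockSum_nonneg (M.blockIndex l) x)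
    (M.blockSum_nonneg (M.blockIndex l) y) (M.m_pos (M.blockIndex l))
  have h3 := M.blockSum_nonneg (M.blockIndex l) x
  have h4 := powBregman_nonneg (M.ω_even l) (M.ω_pos l) (y l) (x l)
  have h5 : (1 : ℝ) ≤ M.m (M.blockIndex l) := by exact_mod_cast M.m_pos _
  have h6 : M.blockSum (M.blockIndex l) x ^ (M.m (M.blockIndex l) - 1) *
      powBregman (M.ω l) (y l) (x l) ≤ M.m (M.blockIndex l) *
      M.blockSum (M.blockIndex l) x ^ (M.m (M.blockIndex l) - 1) *
        ∑ l ∈ M.block (M.blockIndex l), powBregman (M.ω l) (y l) (x l) := by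
    refine mul_le_mul ?_ (M.powBregman_le_sum l y x) h4 (by positivity)
    exact le_mul_of_one_le_left (by positivity) h5
  exact le_add_of_nonneg_of_le h1 h6

/-- This is `pow_defect_lower_bound` with the inner sum of the block as base; the constant 3^(-ω)
comes from `powBregman_ge_pow`. It holds at every x, however degenerate. -/
theorem pow_le_bregman (l : Fin d) (y x : EuclideanSpace ℝ (Fin d)) :
    (3⁻¹) ^ M.ω l * (|y l - x l| / 3) ^ (M.ω l * M.m (M.blockIndex l)) ≤ M.bregman y x := by
  refine le_trans ?_ (M.blockBregman_le (M.blockIndex l) y x)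
  refine pow_defect_lower_bound (M.m_pos _) (M.blockSum_nonneg _ x) (M.blockSum_nonneg _ y)
    (by positivity) (pow_le_one₀ (by norm_num) (by norm_num)) (abs_nonneg _) ?_ (M.ω_pos l) ?_
  · rw [← mul_pow, inv_mul_eq_div]
    exact (powBregman_ge_pow (M.ω_even l) (M.ω_pos l) _ _).trans (M.powBregman_le_sum l y x)
  · exact fun h => (pow_le_of_lt_third_pow (M.ω_even l) (M.pow_le_blockSum l x) h).trans
      (M.pow_le_blockSum l y)

end ModelData

/-! ### The hypersurface F = 1, its normals and its caps -/

theorem EuclideanSpace.norm_le_sum_abs {ι : Type*} [Fintype ι] (x : EuclideanSpace ℝ ι) :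
    ‖x‖ ≤ ∑ i, |x i| := by
  rw [EuclideanSpace.norm_eq]
  refine Real.sqrt_le_iff.mpr ⟨by positivity, ?_⟩
  simp only [Real.norm_eq_abs]
  exact Finset.sum_sq_le_sq_sum_of_nonneg fun i _ => abs_nonneg (x i)

namespace ModelData

variable {d : ℕ} (M : ModelData d)

theorem F_zero : M.F 0 = 0 := by
  rw [F]
  refine Finset.sum_eq_zero fun p _ => ?_
  rw [Finset.sum_eq_zero, zero_pow (M.m_pos p).ne']
  intro l _
  simp [(M.ω_pos l).ne']

theorem blockSum_le_one {x : EuclideanSpace ℝ (Fin d)} (hx : M.F x ≤ 1) (p : Fin M.n) :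
    M.blockSum p x ≤ 1 := by
  have h : M.blockSum p x ^ M.m p ≤ 1 := le_trans
    (Finset.single_le_sum (f := fun p => M.blockSum p x ^ M.m p)
      (fun p _ => pow_nonneg (M.blockSum_nonneg p x) _) (Finset.mem_univ p)) hx
  exact (pow_le_one_iff_of_nonneg (M.blockSum_nonneg p x) (M.m_pos p).ne').mp h

theorem abs_le_one {x : EuclideanSpace ℝ (Fin d)} (hx : M.F x ≤ 1) (l : Fin d) : |x l| ≤ 1 := by
  have h := (M.pow_le_blockSum l x).trans (M.blockSum_le_one hx _)
  rw [← (M.ω_even l).pow_abs] at h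
  exact (pow_le_one_iff_of_nonneg (abs_nonneg _) (M.ω_pos l).ne').mp h

theorem isCompact_domain : IsCompact M.domain := by
  refine Metric.isCompact_of_isClosed_isBounded (isClosed_le M.continuous_F continuous_const) ?_
  refine (Metric.isBounded_closedBall (x := 0) (r := (d : ℝ))).subset fun x hx => ?_
  rw [mem_closedBall_zero_iff]
  calc ‖x‖ ≤ ∑ l, |x l| := EuclideanSpace.norm_le_sum_abs x
    _ ≤ ∑ _l : Fin d, (1 : ℝ) := Finset.sum_le_sum fun l _ => M.abs_le_one hx l
    _ = d := by simp

theorem isCompact_level : IsCompact {x | M.F x = 1} :=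
  M.isCompact_domain.of_isClosed_subset (isClosed_eq M.continuous_F continuous_const)
    fun _ hx => le_of_eq hx

/-- Convexity is compared with the origin, where F vanishes. The bound replaces Euler's identity, as
F need not be homogeneous. -/
theorem one_le_inner_grad {x : EuclideanSpace ℝ (Fin d)} (hx : M.F x = 1) :
    1 ≤ ⟪M.grad x, x⟫_ℝ := by
  have h := M.bregman_nonneg 0 x
  rw [bregman, F_zero, hx, zero_sub, zero_sub, inner_neg_right] at h
  linarith

/-- A point with F = 1 is not interior because F exceeds 1 further out on its ray, by convexity and
`one_le_inner_grad`. -/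
theorem frontier_domain : frontier M.domain = {x | M.F x = 1} := by
  refine Set.Subset.antisymm (frontier_le_subset_eq M.continuous_F continuous_const) fun x hx => ?_
  refine ⟨subset_closure (le_of_eq hx), fun hint => ?_⟩
  have hc : Filter.Tendsto (fun t : ℝ => t • x) (nhdsWithin 1 (Set.Ioi 1)) (nhds x) := by
    have : ContinuousAt (fun t : ℝ => t • x) 1 := by fun_prop
    have h := this.tendsto.mono_left (nhdsWithin_le_nhds (s := Set.Ioi 1))
    simpa using h
  obtain ⟨t, ht, ht1⟩ :=
    ((hc.eventually (mem_interior_iff_mem_nhds.mp hint)).and self_mem_nhdsWithin).exists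
  have ht1 : 1 < t := ht1
  have ht : M.F (t • x) ≤ 1 := ht
  have hb := M.bregman_nonneg (t • x) x
  have hx : M.F x = 1 := hx
  have e : t • x - x = (t - 1) • x := by rw [sub_smul, one_smul]
  rw [bregman, hx, e, inner_smul_right] at hb
  have := M.one_le_inner_grad hx
  nlinarith

theorem mem_frontier_iff {x : EuclideanSpace ℝ (Fin d)} : x ∈ frontier M.domain ↔ M.F x = 1 := by
  rw [frontier_domain]; rfl

theorem grad_ne_zero {x : EuclideanSpace ℝ (Fin d)} (hx : M.F x = 1) : M.grad x ≠ 0 := by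
  intro h
  have := M.one_le_inner_grad hx
  rw [h, inner_zero_left] at this
  linarith

theorem isPointWithNormal_iff {ξ x : EuclideanSpace ℝ (Fin d)} (hξ : ξ ≠ 0) :
    M.IsPointWithNormal ξ x ↔ M.F x = 1 ∧ ∃ a : ℝ, 0 < a ∧ M.grad x = a • ξ := by
  rw [IsPointWithNormal, mem_frontier_iff, exteriorNormal, gradient_F]
  refine and_congr_right fun hx => ⟨fun h => ?_, ?_⟩
  · have hg := norm_pos_iff.mpr (M.grad_ne_zero hx)
    refine ⟨‖M.grad x‖ * ‖ξ‖⁻¹, mul_pos hg (inv_pos.mpr (norm_pos_iff.mpr hξ)), ?_⟩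
    rw [mul_smul, ← h, smul_smul, mul_inv_cancel₀ hg.ne', one_smul]
  · rintro ⟨a, ha, h⟩
    rw [h, norm_smul, Real.norm_of_nonneg ha.le, smul_smul, mul_inv_rev, mul_assoc,
      inv_mul_cancel₀ ha.ne', mul_one]

theorem eq_of_bregman_eq_zero {x y : EuclideanSpace ℝ (Fin d)} (h : M.bregman y x = 0) :
    y = x := by
  ext l
  have h1 := M.pow_le_bregman l y x
  rw [h] at h1
  have h2 : (|y l - x l| / 3) ^ (M.ω l * M.m (M.blockIndex l)) ≤ 0 :=
    nonpos_of_mul_nonpos_right h1 (by positivity)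
  have h3 := pow_eq_zero_iff (mul_pos (M.ω_pos l) (M.m_pos _)).ne' |>.mp
    (le_antisymm h2 (by positivity))
  have h4 : |y l - x l| = 0 := by linarith
  exact sub_eq_zero.mp (abs_eq_zero.mp h4)

/-- The defects D(y, x) and D(x, y) are positive multiples of -⟨ξ, y - x⟩ and ⟨ξ, y - x⟩. Both are
nonnegative, so both vanish. -/
theorem IsPointWithNormal.unique {ξ x y : EuclideanSpace ℝ (Fin d)} (hξ : ξ ≠ 0)
    (hx : M.IsPointWithNormal ξ x) (hy : M.IsPointWithNormal ξ y) : y = x := by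
  obtain ⟨hx1, a, ha, hxa⟩ := (M.isPointWithNormal_iff hξ).mp hx
  obtain ⟨hy1, b, hb, hyb⟩ := (M.isPointWithNormal_iff hξ).mp hy
  have h1 := M.bregman_nonneg y x
  have h2 := M.bregman_nonneg x y
  have e1 : M.bregman y x = -(a * ⟪ξ, y - x⟫_ℝ) := by
    rw [bregman, hx1, hy1, hxa, inner_smul_left]; simp
  have e2 : M.bregman x y = b * ⟪ξ, y - x⟫_ℝ := by
    rw [bregman, hx1, hy1, hyb, inner_smul_left, ← neg_sub y x, inner_neg_right]; simp
  refine M.eq_of_bregman_eq_zero (le_antisymm ?_ h1)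
  rw [e2] at h2
  rw [e1]
  have := nonneg_of_mul_nonneg_right h2 hb
  have := mul_nonneg ha.le this
  linarith

theorem exists_isPointWithNormal {ξ : EuclideanSpace ℝ (Fin d)} (hξ : ξ ≠ 0) :
    ∃ x, M.IsPointWithNormal ξ x := by
  have hF0 : M.F 0 ≤ 1 := by rw [M.F_zero]; exact zero_le_one
  obtain ⟨x, hxD, hmax⟩ := M.isCompact_domain.exists_isMaxOn ⟨0, hF0⟩
    (f := fun y => ⟪ξ, y⟫_ℝ) (by fun_prop)
  -- a point of the open sublevel set can be moved a little in any direction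
  have hmove : ∀ z v : EuclideanSpace ℝ (Fin d), M.F z < 1 → ∃ t : ℝ, 0 < t ∧
      M.F (z + t • v) ≤ 1 := by
    intro z v hz
    have hc : ContinuousAt (fun t : ℝ => M.F (z + t • v)) 0 :=
      (M.continuous_F.comp (by fun_prop : Continuous fun t : ℝ => z + t • v)).continuousAt
    have h := (hc.eventually_lt_const (u := 1) (by simpa using hz)).filter_mono
      (nhdsWithin_le_nhds (s := Set.Ioi 0))
    obtain ⟨t, ht, ht0⟩ := (h.and self_mem_nhdsWithin).exists
    exact ⟨t, ht0, ht.le⟩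
  have hξ2 : 0 < ⟪ξ, ξ⟫_ℝ := real_inner_self_pos.mpr hξ
  have hdir : ∀ z, M.F z < 1 → ⟪ξ, z⟫_ℝ < ⟪ξ, x⟫_ℝ := by
    intro z hz
    obtain ⟨t, ht, h⟩ := hmove z ξ hz
    have h1 : ⟪ξ, z + t • ξ⟫_ℝ ≤ ⟪ξ, x⟫_ℝ := hmax h
    rw [inner_add_right, inner_smul_right] at h1
    have := mul_pos ht hξ2
    linarith
  have hpos : 0 < ⟪ξ, x⟫_ℝ := by
    have := hdir 0 (by rw [M.F_zero]; exact zero_lt_one)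
    rwa [inner_zero_right] at this
  have hx : M.F x = 1 := le_antisymm hxD (not_lt.mp fun h => lt_irrefl _ (hdir x h))
  have hext : IsLocalExtrOn (fun y => ⟪ξ, y⟫_ℝ) {y | M.F y = M.F x} x := by
    refine Or.inr (IsMaxOn.localize fun y hy => hmax ?_)
    have hy : M.F y = M.F x := hy
    exact le_of_eq (hy.trans hx)
  obtain ⟨a, b, hab, h⟩ := hext.exists_multipliers_of_hasStrictFDerivAt_1d
    (M.hasStrictFDerivAt_F x) (InnerProductSpace.toDual ℝ _ ξ).hasStrictFDerivAt
  have h' : ∀ v, a * ⟪M.grad x, v⟫_ℝ + b * ⟪ξ, v⟫_ℝ = 0 := fun v => by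
    have := congrArg (fun φ => φ v) h
    simpa using this
  have hg := M.one_le_inner_grad hx
  -- With a = 0, testing against x would force b = 0, since ⟨ξ, x⟩ > 0.
  have ha : a ≠ 0 := by
    rintro rfl
    have := h' x
    have hb : b = 0 := by
      simpa [hpos.ne'] using this
    exact hab (by rw [hb]; rfl)
  have hgrad : M.grad x = (-(b / a)) • ξ := by
    refine ext_inner_right ℝ fun v => ?_
    rw [inner_smul_left, RCLike.conj_to_real]
    have := h' v
    field_simp
    linarith
  refine ⟨x, (M.isPointWithNormal_iff hξ).mpr ⟨hx, -(b / a), ?_, hgrad⟩⟩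
  -- The multiplier is positive because ⟨∇F(x), x⟩ ≥ 1 and ⟨ξ, x⟩ > 0; the normal is therefore ξ/|ξ|
  -- and not its opposite.
  rw [hgrad, inner_smul_left, RCLike.conj_to_real] at hg
  exact pos_of_mul_pos_left (lt_of_lt_of_le one_pos hg) hpos.le

theorem grad_eq_of_isPointWithNormal {ξ x : EuclideanSpace ℝ (Fin d)}
    (h : M.IsPointWithNormal ξ x) : M.grad x = ‖M.grad x‖ • ‖ξ‖⁻¹ • ξ := by
  have hx := M.mem_frontier_iff.mp h.1
  rw [← h.2, exteriorNormal, gradient_F, smul_smul,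
    mul_inv_cancel₀ (norm_ne_zero_iff.mpr (M.grad_ne_zero hx)), one_smul]

theorem bregman_le_of_mem_cap {x y : EuclideanSpace ℝ (Fin d)} {δ : ℝ} (hx : M.F x = 1)
    (hy : y ∈ M.cap x δ) : M.bregman y x ≤ ‖M.grad x‖ * δ := by
  have hy1 := M.mem_frontier_iff.mp hy.1
  have hg := norm_pos_iff.mpr (M.grad_ne_zero hx)
  have hν : ‖M.exteriorNormal x‖ = 1 := by
    rw [exteriorNormal, gradient_F, norm_smul, norm_inv, norm_norm, inv_mul_cancel₀ hg.ne']
  have hle : |⟪M.exteriorNormal x, y - x⟫_ℝ| ≤ Metric.infDist y (M.tangentPlane x) := by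
    refine (Metric.le_infDist ⟨x, by simp [tangentPlane]⟩).mpr fun z hz => ?_
    have hz : ⟪M.exteriorNormal x, z - x⟫_ℝ = 0 := hz
    have e : y - x = (y - z) + (z - x) := by abel
    rw [e, inner_add_right, hz, add_zero, dist_eq_norm]
    simpa [hν] using abs_real_inner_le_norm (M.exteriorNormal x) (y - z)
  have e : M.bregman y x = ‖M.grad x‖ * -⟪M.exteriorNormal x, y - x⟫_ℝ := by
    rw [bregman, hy1, hx, exteriorNormal, gradient_F, inner_smul_left, RCLike.conj_to_real]
    field_simp
    ring
  rw [e]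
  exact mul_le_mul_of_nonneg_left (((neg_le_abs _).trans hle).trans hy.2.le) hg.le

end ModelData

/-! ### Area of Lipschitz graphs, and the exponents of the minimum -/

/-- A set on which the coordinate `j` is a Lipschitz function of the other coordinates, and which
lies in a box with respect to these, has surface measure at most a multiple of the volume of the
box. -/
theorem euclideanHausdorffMeasure_le_of_lipschitz_graph {d : ℕ} (j : Fin d) {K : ℝ} (hK : 0 ≤ K)
    (A : Set (EuclideanSpace ℝ (Fin d)))
    (hA : ∀ y ∈ A, ∀ z ∈ A, |y j - z j| ≤ K * ∑ l ∈ Finset.univ.erase j, |y l - z l|)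
    (x : EuclideanSpace ℝ (Fin d)) (r : Fin d → ℝ≥0∞)
    (hr : ∀ l, l ≠ j → ∀ y ∈ A, ENNReal.ofReal |y l - x l| ≤ r l) :
    Measure.euclideanHausdorffMeasure (d - 1) A ≤
      ENNReal.ofReal (2 * ((1 + K) * d)) ^ (d - 1) * ∏ l ∈ Finset.univ.erase j, r l := by
  let ι := {l : Fin d // l ≠ j}
  have hcard : Fintype.card ι = d - 1 := by
    simp [ι, Fintype.card_subtype_compl]
  have hfin : Module.finrank ℝ (EuclideanSpace ℝ ι) = d - 1 := by
    rw [finrank_euclideanSpace, hcard]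
  let π : EuclideanSpace ℝ (Fin d) → EuclideanSpace ℝ ι := fun y => WithLp.toLp 2 fun l => y l
  let K' : NNReal := ((1 + K) * d).toNNReal
  have hK' : (K' : ℝ) = (1 + K) * d := Real.coe_toNNReal _ (by positivity)
  -- Forgetting the coordinate j shrinks distances on A by at most the factor (1 + K) d, so the area
  -- of A is controlled by the volume of its projection.
  have hanti : AntilipschitzWith K' (A.domRestrict π) := by
    refine AntilipschitzWith.of_le_mul_dist fun y z => ?_
    have h1 : ∑ l, |(y : EuclideanSpace ℝ (Fin d)) l - (z : EuclideanSpace ℝ (Fin d)) l| ≤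
        (1 + K) * ∑ l ∈ Finset.univ.erase j,
          |(y : EuclideanSpace ℝ (Fin d)) l - (z : EuclideanSpace ℝ (Fin d)) l| := by
      rw [← Finset.add_sum_erase _ _ (Finset.mem_univ j)]
      have := hA y y.2 z z.2
      linarith
    have h2 : ∑ l ∈ Finset.univ.erase j,
        |(y : EuclideanSpace ℝ (Fin d)) l - (z : EuclideanSpace ℝ (Fin d)) l| ≤
        d * dist (π y) (π z) := by
      have h3 : ∀ l ∈ Finset.univ.erase j,
          |(y : EuclideanSpace ℝ (Fin d)) l - (z : EuclideanSpace ℝ (Fin d)) l| ≤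
          dist (π y) (π z) := by
        intro l hl
        rw [dist_eq_norm]
        exact PiLp.norm_apply_le (π y - π z) (⟨l, Finset.ne_of_mem_erase hl⟩ : ι)
      refine (Finset.sum_le_card_nsmul _ _ _ h3).trans ?_
      rw [nsmul_eq_mul]
      refine mul_le_mul_of_nonneg_right ?_ dist_nonneg
      exact_mod_cast (Finset.card_le_univ _).trans (by simp)
    rw [Subtype.dist_eq, dist_eq_norm, hK', mul_assoc]
    exact (EuclideanSpace.norm_le_sum_abs _).trans
      (h1.trans (mul_le_mul_of_nonneg_left h2 (by linarith)))
  have himage : A.domRestrict π '' Set.univ ⊆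
      WithLp.ofLp ⁻¹' Set.univ.pi fun l : ι => Metric.closedEBall (x l) (r l) := by
    rintro _ ⟨y, -, rfl⟩ l -
    rw [Metric.mem_closedEBall, edist_dist, Real.dist_eq]
    exact hr l l.2 y y.2
  have hvol : volume (A.domRestrict π '' Set.univ) ≤ 2 ^ (d - 1) * ∏ l ∈ Finset.univ.erase j, r l := by
    refine (measure_mono himage).trans ?_
    rw [(PiLp.volume_preserving_ofLp ι).measure_preimage (MeasurableSet.univ_pi fun _ =>
      Metric.isClosed_closedEBall.measurableSet).nullMeasurableSet, volume_pi_pi]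
    simp only [Real.volume_closedEBall, Finset.prod_mul_distrib, Finset.prod_const,
      Finset.card_univ, hcard]
    refine le_of_eq ?_
    congr 1
    rw [Finset.prod_subtype (Finset.univ.erase j) (p := fun l => l ≠ j) (by simp)]
  have hle := hanti.le_hausdorffMeasure_image (d := ((d - 1 : ℕ) : ℝ)) (Nat.cast_nonneg _) Set.univ
  have hAuniv : Measure.hausdorffMeasure ((d - 1 : ℕ) : ℝ) A =
      Measure.hausdorffMeasure ((d - 1 : ℕ) : ℝ) (Set.univ : Set A) := by
    rw [← isometry_subtype_coe.hausdorffMeasure_image (Or.inl (Nat.cast_nonneg _)) Set.univ]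
    simp
  rw [ENNReal.rpow_natCast] at hle
  have hvol' : Measure.euclideanHausdorffMeasure (d - 1) (A.domRestrict π '' Set.univ) =
      volume (A.domRestrict π '' Set.univ) := by
    rw [← hfin, InnerProductSpace.euclideanHausdorffMeasure_eq_volume]
  calc Measure.euclideanHausdorffMeasure (d - 1) A
      ≤ K' ^ (d - 1) * Measure.euclideanHausdorffMeasure (d - 1) (A.domRestrict π '' Set.univ) := by
        -- Both sides carry the same normalizing scalar, as the dimension is d - 1 on both.
        rw [Measure.euclideanHausdorffMeasure_def, Measure.euclideanHausdorffMeasure_def,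
          Measure.smul_apply, Measure.smul_apply, hAuniv, mul_smul_comm]
        gcongr
    _ ≤ K' ^ (d - 1) * (2 ^ (d - 1) * ∏ l ∈ Finset.univ.erase j, r l) := by
        rw [hvol']; gcongr
    _ = _ := by
        rw [← mul_assoc, ← mul_pow, mul_comm (K' : ℝ≥0∞), ENNReal.ofReal_mul two_pos.le]
        simp [K', ENNReal.ofReal]

/-- The two bounds for `u` amount to `u` being at most the minimum in `ModelData.factor`. -/
theorem ENNReal.ofReal_le_min_rpow {k : ℕ} (hk : 2 ≤ k) {X η u : ℝ} (hX : 0 < X) (hη : 0 ≤ η)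
    (hu : 0 ≤ u) (h1 : u ^ k ≤ X⁻¹) (h2 : η ^ (k - 2) * u ^ (2 * (k - 1)) ≤ X⁻¹ ^ (k - 1)) :
    ENNReal.ofReal u ≤ min (ENNReal.ofReal X ^ (-(1 / (k : ℝ))))
      (ENNReal.ofReal X ^ (-(1 / 2) : ℝ) *
        ENNReal.ofReal η ^ (-(((k : ℝ) - 2) / (2 * ((k : ℝ) - 1))))) := by
  have hk0 : (0 : ℝ) < k := by positivity
  have hk2 : (2 : ℝ) ≤ k := by exact_mod_cast hk
  have hX0 : ENNReal.ofReal X ≠ 0 := by simpa using hX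
  have h1' : ENNReal.ofReal u ^ k ≤ (ENNReal.ofReal X)⁻¹ := by
    rw [← ENNReal.ofReal_pow hu, ← ENNReal.ofReal_inv_of_pos hX]
    exact ENNReal.ofReal_le_ofReal h1
  have h2' : ENNReal.ofReal η ^ (k - 2) * ENNReal.ofReal u ^ (2 * (k - 1)) ≤
      (ENNReal.ofReal X)⁻¹ ^ (k - 1) := by
    rw [← ENNReal.ofReal_pow hu, ← ENNReal.ofReal_inv_of_pos hX, ← ENNReal.ofReal_pow hη,
      ← ENNReal.ofReal_mul (by positivity), ← ENNReal.ofReal_pow (by positivity)]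
    exact ENNReal.ofReal_le_ofReal h2
  have c1 : ((k - 1 : ℕ) : ℝ) = k - 1 := by push_cast [show 1 ≤ k by omega]; ring
  have c2 : ((k - 2 : ℕ) : ℝ) = k - 2 := by push_cast [hk]; ring
  refine le_min ?_ ?_
  · have h := ENNReal.rpow_le_rpow h1' (z := 1 / (k : ℝ)) (by positivity)
    rw [← ENNReal.rpow_natCast, ← ENNReal.rpow_mul, mul_one_div_cancel hk0.ne', ENNReal.rpow_one,
      ENNReal.inv_rpow, ← ENNReal.rpow_neg] at h
    exact h
  · have h := ENNReal.rpow_le_rpow h2' (z := 1 / (2 * ((k : ℝ) - 1))) (by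
      have : (0 : ℝ) < (k : ℝ) - 1 := by linarith
      positivity)
    have hne : (k : ℝ) - 1 ≠ 0 := by linarith
    rw [ENNReal.mul_rpow_of_nonneg _ _ (by
        have : (0 : ℝ) < (k : ℝ) - 1 := by linarith
        positivity)] at h
    simp only [← ENNReal.rpow_natCast, ← ENNReal.rpow_mul, Nat.cast_mul, Nat.cast_ofNat, c1, c2]
      at h
    rw [mul_one_div_cancel (by simpa using hne), ENNReal.rpow_one, mul_one_div,
      show ((k : ℝ) - 1) * (1 / (2 * ((k : ℝ) - 1))) = 1 / 2 by field_simp, ENNReal.inv_rpow,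
      ← ENNReal.rpow_neg, mul_comm] at h
    rw [ENNReal.rpow_neg _ (((k : ℝ) - 2) / (2 * ((k : ℝ) - 1))), ← div_eq_mul_inv]
    -- The power of η in the denominator may be 0; the division is legitimate because the numerator,
    -- a power of X, is not 0.
    refine (ENNReal.le_div_iff_mul_le (Or.inr ?_) (Or.inl ?_)).mpr h
    · simp [ENNReal.rpow_eq_zero_iff]
    · refine ENNReal.rpow_ne_top_of_nonneg ?_ ENNReal.ofReal_ne_top
      exact div_nonneg (by linarith) (by linarith)

/-! ### The level set as a union of Lipschitz graphs -/

namespace ModelData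

variable {d : ℕ} (M : ModelData d)

theorem exists_norm_grad_le : ∃ L : ℝ, 1 ≤ L ∧ ∀ x, M.F x = 1 → ‖M.grad x‖ ≤ L := by
  obtain ⟨L, hL⟩ := M.isCompact_level.exists_bound_of_continuousOn M.continuous_grad.continuousOn
  exact ⟨max 1 L, le_max_left _ _, fun x hx => (hL x hx).trans (le_max_right _ _)⟩

theorem exists_inv_le_norm_grad : ∃ R : ℝ, 1 ≤ R ∧ ∀ x, M.F x = 1 → R⁻¹ ≤ ‖M.grad x‖ := by
  obtain ⟨R, hR⟩ := M.isCompact_level.exists_bound_of_continuousOn continuous_id.continuousOn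
  refine ⟨max 1 R, le_max_left _ _, fun x hx => ?_⟩
  have h1 := (M.one_le_inner_grad hx).trans (real_inner_le_norm _ _)
  have h2 : ‖x‖ ≤ max 1 R := (hR x hx).trans (le_max_right _ _)
  rw [inv_le_iff_one_le_mul₀ (by positivity)]
  exact h1.trans (by gcongr)

/-- Where the partial derivative `∂_j F` is bounded away from `0`, the level set `{F = 1}` is a
Lipschitz graph over the hyperplane `x_j = 0`. -/
theorem exists_measure_le_of_grad_ge {c : ℝ} (hc : 0 < c) :
    ∃ K : ℝ, 0 ≤ K ∧ ∀ (j : Fin d) (s : ℝ), |s| = 1 → ∀ A : Set (EuclideanSpace ℝ (Fin d)),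
      (∀ y ∈ A, M.F y = 1 ∧ c ≤ s * M.grad y j) →
      ∀ (x : EuclideanSpace ℝ (Fin d)) (r : Fin d → ℝ≥0∞),
      (∀ l, l ≠ j → ∀ y ∈ A, ENNReal.ofReal |y l - x l| ≤ r l) →
      Measure.euclideanHausdorffMeasure (d - 1) A ≤
        ENNReal.ofReal K * ∏ l ∈ Finset.univ.erase j, r l := by
  obtain ⟨L, hL1, hL⟩ := M.exists_norm_grad_le
  have hLc : 0 ≤ L / c := by positivity
  refine ⟨(2 * ((1 + L / c) * d)) ^ (d - 1), by positivity, fun j s hs A hA x r hr => ?_⟩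
  rw [ENNReal.ofReal_pow (by positivity)]
  refine euclideanHausdorffMeasure_le_of_lipschitz_graph j hLc A ?_ x r hr
  -- Convexity at z gives ⟨∇F(z), y - z⟩ ≤ 0, so the term of the coordinate j, here at least c|y_j -
  -- z_j|, is bounded by the other terms. No smallness or connectedness of A is needed.
  have key : ∀ y ∈ A, ∀ z ∈ A, 0 ≤ s * (y j - z j) →
      |y j - z j| ≤ L / c * ∑ l ∈ Finset.univ.erase j, |y l - z l| := by
    intro y hy z hz hyz
    have h0 := M.bregman_nonneg y z
    rw [bregman, (hA y hy).1, (hA z hz).1, PiLp.inner_apply,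
      ← Finset.add_sum_erase _ _ (Finset.mem_univ j)] at h0
    have h1 : |y j - z j| = s * (y j - z j) := by
      rw [← abs_of_nonneg hyz, abs_mul, hs, one_mul]
    have h2 : c * |y j - z j| ≤ M.grad z j * (y j - z j) := by
      have hs2 : s * s = 1 := by rw [← abs_mul_abs_self, hs, one_mul]
      calc c * |y j - z j| ≤ s * M.grad z j * |y j - z j| :=
            mul_le_mul_of_nonneg_right (hA z hz).2 (abs_nonneg _)
        _ = s * s * (M.grad z j * (y j - z j)) := by rw [h1]; ring
        _ = _ := by rw [hs2, one_mul]
    have h3 : -∑ l ∈ Finset.univ.erase j, inner ℝ (M.grad z l) ((y - z) l) ≤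
        L * ∑ l ∈ Finset.univ.erase j, |y l - z l| := by
      rw [← Finset.sum_neg_distrib, Finset.mul_sum]
      refine Finset.sum_le_sum fun l _ => (neg_le_abs _).trans ?_
      have : |M.grad z l| ≤ L := (PiLp.norm_apply_le (M.grad z) l).trans (hL z (hA z hz).1)
      simp only [RCLike.inner_apply, conj_trivial, PiLp.sub_apply, abs_mul]
      rw [mul_comm]
      gcongr
    rw [div_mul_eq_mul_div, le_div_iff₀ hc]
    simp only [RCLike.inner_apply, conj_trivial, PiLp.sub_apply] at h0 h3
    linarith
  intro y hy z hz
  rcases le_total 0 (s * (y j - z j)) with h | h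
  · exact key y hy z hz h
  · have := key z hz y hy (by linarith)
    simpa only [abs_sub_comm] using this

/-- Since ⟨∇F(y), y⟩ ≥ 1 and all |y_l| ≤ 1, some partial derivative has modulus at least 1/(d+1).
Thus 2d graphs, one for each coordinate and sign, cover the level set. -/
theorem exists_measure_level_le :
    ∃ K : ℝ, 0 ≤ K ∧ Measure.euclideanHausdorffMeasure (d - 1) {x | M.F x = 1} ≤
      ENNReal.ofReal K := by
  let c : ℝ := ((d : ℝ) + 1)⁻¹
  have hc : 0 < c := by positivity
  obtain ⟨K, hK0, hK⟩ := M.exists_measure_le_of_grad_ge hc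
  let A : Fin d × Bool → Set (EuclideanSpace ℝ (Fin d)) := fun q =>
    {y | M.F y = 1 ∧ c ≤ (if q.2 then 1 else -1) * M.grad y q.1}
  have hA : ∀ q, Measure.euclideanHausdorffMeasure (d - 1) (A q) ≤ ENNReal.ofReal K := by
    intro q
    have := hK q.1 (if q.2 then 1 else -1) (by split_ifs <;> simp) (A q) (fun y hy => hy) 0
      (fun _ => 1) (fun l _ y hy => by
        simpa using M.abs_le_one hy.1.le l)
    simpa using this
  have hcover : {x | M.F x = 1} ⊆ ⋃ q, A q := by
    intro y hy
    have h1 := M.one_le_inner_grad hy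
    have h2 : ∃ l, c ≤ |M.grad y l| := by
      by_contra! hcon
      have h3 : ⟪M.grad y, y⟫_ℝ ≤ ∑ _l : Fin d, c := by
        rw [PiLp.inner_apply]
        refine Finset.sum_le_sum fun l _ => (le_abs_self _).trans ?_
        simp only [RCLike.inner_apply, conj_trivial, abs_mul]
        have h4 := M.abs_le_one (le_of_eq hy) l
        calc |y l| * |M.grad y l| ≤ 1 * c := by
              gcongr
              exact (hcon l).le
          _ = c := one_mul c
      have h5 : ∑ _l : Fin d, c < 1 := by
        simp only [Finset.sum_const, Finset.card_univ, Fintype.card_fin, nsmul_eq_mul, c]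
        rw [mul_inv_lt_iff₀ (by positivity)]
        linarith
      linarith
    obtain ⟨l, hl⟩ := h2
    rw [Set.mem_iUnion]
    rcases le_abs.mp hl with h | h
    · exact ⟨(l, true), hy, by simpa using h⟩
    · exact ⟨(l, false), hy, by simpa using h⟩
  refine ⟨∑ _q : Fin d × Bool, K, by positivity, ?_⟩
  refine (measure_mono hcover).trans ((measure_iUnion_fintype_le _ _).trans ?_)
  rw [ENNReal.ofReal_sum_of_nonneg fun _ _ => hK0]
  exact Finset.sum_le_sum fun q _ => hA q

end ModelData

/-! ### The extent of a cap in each coordinate -/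

namespace ModelData

variable {d : ℕ} (M : ModelData d)

theorem two_le_ω (l : Fin d) : 2 ≤ M.ω l := by
  have h1 := M.ω_pos l
  obtain ⟨r, hr⟩ := M.ω_even l
  omega

theorem mm_pos (j l : Fin d) : 0 < M.mm j l := by
  unfold mm; split_ifs
  · exact one_pos
  · exact M.m_pos _

theorem mm_le (j l : Fin d) : M.mm j l ≤ M.m (M.blockIndex l) := by
  unfold mm; split_ifs
  · exact M.m_pos _
  · exact le_rfl

theorem two_le_mm_mul_ω (j l : Fin d) : 2 ≤ M.mm j l * M.ω l :=
  (M.two_le_ω l).trans (Nat.le_mul_of_pos_left _ (M.mm_pos j l))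

/-- The sum of the orders `m_{p(l)+1} ω_l`, increased by one. -/
noncomputable def order : ℕ := ∑ l, M.m (M.blockIndex l) * M.ω l + 1

theorem m_mul_ω_le_order (l : Fin d) : M.m (M.blockIndex l) * M.ω l ≤ M.order :=
  (Finset.single_le_sum (f := fun l => M.m (M.blockIndex l) * M.ω l) (fun _ _ => Nat.zero_le _)
    (Finset.mem_univ l)).trans (Nat.le_succ _)

theorem mm_mul_ω_le_order (j l : Fin d) : M.mm j l * M.ω l ≤ M.order :=
  (Nat.mul_le_mul_right _ (M.mm_le j l)).trans (M.m_mul_ω_le_order l)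

/-- The size of the second derivative of `F` in direction `l`, as seen from direction `j`. -/
noncomputable def weight (j l : Fin d) (x : EuclideanSpace ℝ (Fin d)) : ℝ :=
  M.blockSum (M.blockIndex l) x ^ (M.mm j l - 1) * |x l| ^ (M.ω l - 2)

theorem weight_nonneg (j l : Fin d) (x : EuclideanSpace ℝ (Fin d)) : 0 ≤ M.weight j l x := by
  have := M.blockSum_nonneg (M.blockIndex l) x
  unfold weight
  positivity

/-- The power of the inner sum in W is bounded below through |x_l|^ω_l ≤ S. -/
theorem abs_pow_le_weight (j l : Fin d) (x : EuclideanSpace ℝ (Fin d)) :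
    |x l| ^ (M.mm j l * M.ω l - 2) ≤ M.weight j l x := by
  obtain ⟨a, ha⟩ : ∃ a, M.mm j l = a + 1 := ⟨M.mm j l - 1, by have := M.mm_pos j l; omega⟩
  have h2 := M.two_le_ω l
  have e : M.mm j l * M.ω l - 2 = M.ω l * a + (M.ω l - 2) := by
    rw [ha, add_mul, one_mul, mul_comm a]; omega
  rw [weight, e, pow_add, ha, Nat.add_sub_cancel, pow_mul, (M.ω_even l).pow_abs]
  have := M.pow_le_blockSum l x
  have := (M.ω_even l).pow_nonneg (x l)
  gcongr

theorem abs_grad_le_blockSum_pow (l : Fin d) (x : EuclideanSpace ℝ (Fin d)) :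
    |M.grad x l| ≤ M.order * (M.blockSum (M.blockIndex l) x ^ (M.m (M.blockIndex l) - 1) *
      |x l| ^ (M.ω l - 2) * |x l|) := by
  have h0 := M.blockSum_nonneg (M.blockIndex l) x
  have h2 := M.two_le_ω l
  have h3 : ((M.m (M.blockIndex l) * M.ω l : ℕ) : ℝ) ≤ M.order := by
    exact_mod_cast M.m_mul_ω_le_order l
  have e : |M.grad x l| = ((M.m (M.blockIndex l) * M.ω l : ℕ) : ℝ) *
      (M.blockSum (M.blockIndex l) x ^ (M.m (M.blockIndex l) - 1) *
      |x l| ^ (M.ω l - 2) * |x l|) := by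
    rw [grad_apply, abs_mul, abs_mul, abs_mul, abs_pow, abs_pow, abs_of_nonneg h0,
      Nat.abs_cast, Nat.abs_cast, show M.ω l - 1 = M.ω l - 2 + 1 by omega, pow_succ]
    push_cast
    ring
  rw [e]
  gcongr

theorem blockSum_pow_le_blockSum_pow_mm {x : EuclideanSpace ℝ (Fin d)} (hx : M.F x = 1)
    (j l : Fin d) : M.blockSum (M.blockIndex l) x ^ (M.m (M.blockIndex l) - 1) ≤
      M.blockSum (M.blockIndex l) x ^ (M.mm j l - 1) :=
  pow_le_pow_of_le_one (M.blockSum_nonneg _ _) (M.blockSum_le_one hx.le _)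
    (Nat.sub_le_sub_right (M.mm_le j l) 1)

/-- On the level set S ≤ 1, so lowering the exponent of S from m - 1 to m_{j,l} - 1 only enlarges
the bound. -/
theorem abs_grad_le_weight {x : EuclideanSpace ℝ (Fin d)} (hx : M.F x = 1) (j l : Fin d) :
    |M.grad x l| ≤ M.order * (M.weight j l x * |x l|) := by
  refine (M.abs_grad_le_blockSum_pow l x).trans ?_
  unfold weight
  have := M.blockSum_pow_le_blockSum_pow_mm hx j l
  gcongr

theorem abs_grad_le_blockSum {x : EuclideanSpace ℝ (Fin d)} (hx : M.F x = 1) (j : Fin d) :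
    |M.grad x j| ≤ M.order * M.blockSum (M.blockIndex j) x ^ (M.m (M.blockIndex j) - 1) := by
  refine (M.abs_grad_le_blockSum_pow j x).trans ?_
  have h0 := M.blockSum_nonneg (M.blockIndex j) x
  have h1 := M.abs_le_one hx.le j
  rw [mul_assoc (_ ^ _)]
  have h2 : |x j| ^ (M.ω j - 2) * |x j| ≤ 1 :=
    mul_le_one₀ (pow_le_one₀ (abs_nonneg _) h1) (abs_nonneg _) h1
  have h3 := mul_le_of_le_one_right (pow_nonneg h0 (M.m (M.blockIndex j) - 1)) h2
  gcongr

/-- If the block of `j` does not degenerate at `x`, the convexity defect controls both the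
`m_{j,l} ω_l`-th power and the weighted square of the increment in direction `l`. -/
theorem increment_le_bregman {c : ℝ} (hc0 : 0 < c) (hc1 : c ≤ 1) {x : EuclideanSpace ℝ (Fin d)}
    {j : Fin d}
    (hc : c ≤ M.blockSum (M.blockIndex j) x ^ (M.m (M.blockIndex j) - 1))
    (y : EuclideanSpace ℝ (Fin d)) (l : Fin d) :
    c * (|y l - x l| / 9) ^ (M.mm j l * M.ω l) ≤ M.bregman y x ∧
      c * (M.weight j l x * |y l - x l| ^ 2) ≤ M.bregman y x := by
  have hB0 := M.bregman_nonneg y x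
  have ht : 0 ≤ |y l - x l| := abs_nonneg _
  have hsq := powBregman_ge_sq (M.ω_even l) (M.ω_pos l) (y l) (x l)
  have hpow := powBregman_ge_pow (M.ω_even l) (M.ω_pos l) (y l) (x l)
  have hmain := M.blockSum_pow_mul_powBregman_le l y x
  have hS := M.blockSum_nonneg (M.blockIndex l) x
  have hP := powBregman_nonneg (M.ω_even l) (M.ω_pos l) (y l) (x l)
  by_cases h : M.blockIndex j = M.blockIndex l
  · have hmm : M.mm j l = 1 := if_pos h
    rw [h] at hc
    have hmain' : c * powBregman (M.ω l) (y l) (x l) ≤ M.bregman y x :=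
      (mul_le_mul_of_nonneg_right hc hP).trans hmain
    constructor
    · refine le_trans ?_ hmain'
      rw [hmm, one_mul]
      refine mul_le_mul_of_nonneg_left (le_trans ?_ hpow) hc0.le
      exact pow_le_pow_left₀ (by positivity) (by linarith) _
    · refine le_trans ?_ hmain'
      rw [weight, hmm, Nat.sub_self, pow_zero, one_mul]
      exact mul_le_mul_of_nonneg_left hsq hc0.le
  · have hmm : M.mm j l = M.m (M.blockIndex l) := if_neg h
    constructor
    · refine le_trans ?_ (M.pow_le_bregman l y x)
      rw [hmm, mul_comm (M.m _)]
      refine (mul_le_of_le_one_left (by positivity) hc1).trans ?_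
      -- The division by 9 instead of 3 absorbs the constant 3^(-ω) of `pow_le_bregman`.
      have e : (|y l - x l| / 9) ^ (M.ω l * M.m (M.blockIndex l)) =
          (3⁻¹) ^ (M.ω l * M.m (M.blockIndex l)) *
            (|y l - x l| / 3) ^ (M.ω l * M.m (M.blockIndex l)) := by
        rw [← mul_pow]; congr 1; ring
      rw [e]
      refine mul_le_mul_of_nonneg_right ?_ (by positivity)
      exact pow_le_pow_of_le_one (by norm_num) (by norm_num)
        (Nat.le_mul_of_pos_right _ (M.m_pos _))
    · refine (mul_le_of_le_one_left (mul_nonneg (M.weight_nonneg _ _ _) (sq_nonneg _)) hc1).trans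
        (le_trans ?_ hmain)
      rw [weight, hmm, mul_assoc]
      gcongr

/-- The two bounds for the extent of a cap in direction `l`, after division by a constant. -/
theorem exists_cap_extent {ε₀ : ℝ} (hε₀ : 0 < ε₀) (hε₁ : ε₀ ≤ 1) :
    ∃ H : ℝ, 1 ≤ H ∧ ∀ (j : Fin d) (ξ x y : EuclideanSpace ℝ (Fin d)), ξ ≠ 0 →
      ε₀ ≤ |ξ j| / ‖ξ‖ → M.IsPointWithNormal ξ x → y ∈ M.cap x ‖ξ‖⁻¹ → ∀ l,
        (|y l - x l| / H) ^ (M.mm j l * M.ω l) ≤ ‖ξ‖⁻¹ ∧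
        (|ξ l| / ‖ξ‖) ^ (M.mm j l * M.ω l - 2) *
          (|y l - x l| / H) ^ (2 * (M.mm j l * M.ω l - 1)) ≤ ‖ξ‖⁻¹ ^ (M.mm j l * M.ω l - 1) := by
  obtain ⟨L, hL1, hL⟩ := M.exists_norm_grad_le
  obtain ⟨R, hR1, hR⟩ := M.exists_inv_le_norm_grad
  have hN1 : (1 : ℝ) ≤ M.order := by
    exact_mod_cast Nat.le_add_left 1 _
  have hRN : 1 ≤ R * M.order := one_le_mul_of_one_le_of_one_le hR1 hN1
  have hRN0 : 0 < R * M.order := by linarith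
  have hc0 : 0 < ε₀ / (R * M.order) := by positivity
  have hc1 : ε₀ / (R * M.order) ≤ 1 := (div_le_one hRN0).mpr (hε₁.trans hRN)
  set c : ℝ := ε₀ / (R * M.order) with hc
  have hLc : 1 ≤ L / c := (one_le_div hc0).mpr (hc1.trans hL1)
  have hH : 1 ≤ 9 * (R * M.order) * (L / c) := by nlinarith
  refine ⟨9 * (R * M.order) * (L / c), hH, fun j ξ x y hξ hj hx hy l => ?_⟩
  set H : ℝ := 9 * (R * M.order) * (L / c) with hHdef
  have hx1 := M.mem_frontier_iff.mp hx.1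
  have hξ0 : 0 < ‖ξ‖ := norm_pos_iff.mpr hξ
  have hδ : 0 < ‖ξ‖⁻¹ := inv_pos.mpr hξ0
  have hη : ∀ i, |ξ i| / ‖ξ‖ ≤ R * |M.grad x i| := by
    intro i
    have e : |M.grad x i| = ‖M.grad x‖ * (|ξ i| / ‖ξ‖) := by
      conv_lhs => rw [M.grad_eq_of_isPointWithNormal hx]
      simp [abs_mul, div_eq_inv_mul]
    rw [e, ← mul_assoc]
    refine le_mul_of_one_le_left (by positivity) ?_
    have := hR x hx1
    rwa [inv_le_iff_one_le_mul₀' (by linarith)] at this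
  -- A large |ξ_j|/|ξ| forces a large |∂_j F(x)|, which is possible only if the outer derivative of
  -- the block of j is not small.
  have hcS : c ≤ M.blockSum (M.blockIndex j) x ^ (M.m (M.blockIndex j) - 1) := by
    rw [hc, div_le_iff₀ hRN0]
    have h1 := hj.trans (hη j)
    have h2 := M.abs_grad_le_blockSum hx1 j
    calc ε₀ ≤ R * |M.grad x j| := h1
      _ ≤ R * (M.order * M.blockSum (M.blockIndex j) x ^ (M.m (M.blockIndex j) - 1)) := by gcongr
      _ = _ := by ring
  have hB : M.bregman y x ≤ L * ‖ξ‖⁻¹ :=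
    (M.bregman_le_of_mem_cap hx1 hy).trans (mul_le_mul_of_nonneg_right (hL x hx1) hδ.le)
  obtain ⟨h1, h2⟩ := M.increment_le_bregman hc0 hc1 hcS y l
  have hk := M.two_le_mm_mul_ω j l
  have hW := M.abs_pow_le_weight j l x
  have hWη : |ξ l| / ‖ξ‖ ≤ R * M.order * (M.weight j l x * |x l|) := by
    refine (hη l).trans ?_
    rw [mul_assoc]
    exact mul_le_mul_of_nonneg_left (M.abs_grad_le_weight hx1 j l) (by linarith)
  have hW0 := M.weight_nonneg j l x
  set W := M.weight j l x
  set k := M.mm j l * M.ω l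
  set η := |ξ l| / ‖ξ‖
  have hη0 : 0 ≤ η := by positivity
  set t := |y l - x l|
  have ht : 0 ≤ t := abs_nonneg _
  have h1' : (t / 9) ^ k ≤ L / c * ‖ξ‖⁻¹ := by
    rw [div_mul_eq_mul_div, le_div_iff₀ hc0]
    linarith
  have h2' : W * t ^ 2 ≤ L / c * ‖ξ‖⁻¹ := by
    rw [div_mul_eq_mul_div, le_div_iff₀ hc0]
    linarith
  have hLc0 : 0 < L / c := by linarith
  constructor
  · have e : (t / H) ^ k = (t / 9) ^ k / (R * M.order * (L / c)) ^ k := by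
      rw [← div_pow, hHdef, div_div, mul_assoc]
    rw [e, div_le_iff₀ (by positivity)]
    refine h1'.trans ?_
    rw [mul_comm]
    refine mul_le_mul_of_nonneg_left ?_ hδ.le
    refine le_trans ?_ (le_self_pow₀ (one_le_mul_of_one_le_of_one_le hRN hLc) (by omega))
    exact le_mul_of_one_le_left hLc0.le hRN
  · obtain ⟨i, hi⟩ : ∃ i, k = i + 2 := ⟨k - 2, by omega⟩
    rw [hi] at hW ⊢
    simp only [Nat.add_sub_cancel, show i + 2 - 1 = i + 1 by omega] at hW ⊢
    -- With k = i + 2, the i-th power of η ≲ W|x_l| is combined with |x_l|^i ≤ W, which removes x_l.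
    have h3 : η ^ i ≤ (R * M.order) ^ i * W ^ (i + 1) := by
      calc η ^ i ≤ (R * M.order * (W * |x l|)) ^ i := pow_le_pow_left₀ hη0 hWη i
        _ = (R * M.order) ^ i * (W ^ i * |x l| ^ i) := by
            rw [mul_pow (R * _), mul_pow W]
        _ ≤ (R * M.order) ^ i * (W ^ i * W) := by gcongr
        _ = _ := by rw [pow_succ]
    rw [div_pow t, mul_div_assoc', div_le_iff₀ (by positivity), pow_mul, pow_mul]
    calc η ^ i * (t ^ 2) ^ (i + 1)
        ≤ (R * M.order) ^ i * W ^ (i + 1) * (t ^ 2) ^ (i + 1) := by gcongr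
      _ = (R * M.order) ^ i * (W * t ^ 2) ^ (i + 1) := by rw [mul_pow]; ring
      _ ≤ (R * M.order) ^ (i + 1) * (L / c * ‖ξ‖⁻¹) ^ (i + 1) := by
          gcongr
          exact Nat.le_succ i
      _ = ‖ξ‖⁻¹ ^ (i + 1) * (R * M.order * (L / c)) ^ (i + 1) := by
          rw [← mul_pow, ← mul_pow]; congr 1; ring
      _ ≤ ‖ξ‖⁻¹ ^ (i + 1) * (H ^ 2) ^ (i + 1) := by
          gcongr
          calc R * M.order * (L / c) ≤ H := by rw [hHdef]; nlinarith
            _ ≤ H ^ 2 := le_self_pow₀ hH two_ne_zero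

theorem ofReal_le_factor {ξ : EuclideanSpace ℝ (Fin d)} (hξ : ξ ≠ 0) {j l : Fin d} {u : ℝ}
    (hu : 0 ≤ u) (h1 : u ^ (M.mm j l * M.ω l) ≤ ‖ξ‖⁻¹)
    (h2 : (|ξ l| / ‖ξ‖) ^ (M.mm j l * M.ω l - 2) * u ^ (2 * (M.mm j l * M.ω l - 1)) ≤
      ‖ξ‖⁻¹ ^ (M.mm j l * M.ω l - 1)) :
    ENNReal.ofReal u ≤ M.factor ξ j l := by
  have := ENNReal.ofReal_le_min_rpow (M.two_le_mm_mul_ω j l) (norm_pos_iff.mpr hξ)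
    (by positivity : 0 ≤ |ξ l| / ‖ξ‖) hu h1 h2
  rw [Nat.cast_mul] at this
  exact this

/-- The value u = X⁻¹ satisfies both bounds of `ofReal_le_factor`, because u ≤ 1, u ≤ |ξ|⁻¹,
|ξ_l|/|ξ| ≤ 1 and k ≥ 2. -/
theorem le_factor_of_norm_le {ξ : EuclideanSpace ℝ (Fin d)} (hξ : ξ ≠ 0) {X : ℝ} (hX : 1 ≤ X)
    (h : ‖ξ‖ ≤ X) (j l : Fin d) : ENNReal.ofReal X⁻¹ ≤ M.factor ξ j l := by
  have hX0 : 0 < X := by linarith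
  have hk := M.two_le_mm_mul_ω j l
  have hXi : 0 ≤ X⁻¹ := by positivity
  have hXi1 : X⁻¹ ≤ 1 := inv_le_one_of_one_le₀ hX
  have hle : X⁻¹ ≤ ‖ξ‖⁻¹ := inv_anti₀ (norm_pos_iff.mpr hξ) h
  have hη : |ξ l| / ‖ξ‖ ≤ 1 := div_le_one_of_le₀ (PiLp.norm_apply_le ξ l) (norm_nonneg _)
  refine M.ofReal_le_factor hξ hXi ?_ ?_
  · exact (pow_le_of_le_one hXi hXi1 (by omega)).trans hle
  · calc _ ≤ 1 * X⁻¹ ^ (2 * (M.mm j l * M.ω l - 1)) := by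
          gcongr
          exact pow_le_one₀ (by positivity) hη
      _ ≤ X⁻¹ ^ (M.mm j l * M.ω l - 1) := by
          rw [one_mul]
          exact pow_le_pow_of_le_one hXi hXi1 (by omega)
      _ ≤ _ := pow_le_pow_left₀ hXi hle _

/-- For large `‖ξ‖`, the partial derivative `∂_j F` is bounded away from `0` on the cap. -/
theorem exists_grad_ge_on_cap {ε₀ : ℝ} (hε₀ : 0 < ε₀) (hε₁ : ε₀ ≤ 1) :
    ∃ c X : ℝ, 0 < c ∧ 1 ≤ X ∧ ∀ (j : Fin d) (ξ x y : EuclideanSpace ℝ (Fin d)), X < ‖ξ‖ →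
      ε₀ ≤ |ξ j| / ‖ξ‖ → M.IsPointWithNormal ξ x → y ∈ M.cap x ‖ξ‖⁻¹ →
        c ≤ SignType.sign (ξ j) * M.grad y j := by
  obtain ⟨R, hR1, hR⟩ := M.exists_inv_le_norm_grad
  obtain ⟨H, hH1, hH⟩ := M.exists_cap_extent hε₀ hε₁
  have hc : 0 < ε₀ / (2 * R) := by positivity
  obtain ⟨ρ, hρ, hunif⟩ := Metric.uniformContinuousOn_iff.mp
    (M.isCompact_level.uniformContinuousOn_of_continuous M.continuous_grad.continuousOn) _ hc
  let ρ' := ρ / (d + 1)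
  have hρ' : 0 < ρ' := by positivity
  let Y := max 1 (H / ρ')
  have hY1 : 1 ≤ Y := le_max_left _ _
  -- All exponents k are at most `order`, so |ξ| > Y^order makes every extent of the cap smaller
  -- than ρ'. The derivative is at least ε₀/R in modulus at x and varies by less than half of this.
  refine ⟨ε₀ / (2 * R), Y ^ M.order, hc, one_le_pow₀ hY1, fun j ξ x y hX hj hx hy => ?_⟩
  have hξ0 : 0 < ‖ξ‖ := lt_trans (by positivity) hX
  have hx1 := M.mem_frontier_iff.mp hx.1
  have hy1 := M.mem_frontier_iff.mp hy.1
  have hcoord : ∀ l, |y l - x l| < ρ' := by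
    intro l
    obtain ⟨h1, -⟩ := hH j ξ x y (norm_pos_iff.mp hξ0) hj hx hy l
    by_contra! hcon
    have h2 : Y⁻¹ ≤ |y l - x l| / H := by
      calc Y⁻¹ ≤ (H / ρ')⁻¹ := inv_anti₀ (by positivity) (le_max_right _ _)
        _ = ρ' / H := inv_div _ _
        _ ≤ _ := by gcongr
    have h3 : ‖ξ‖⁻¹ < Y⁻¹ ^ M.order := by
      rw [inv_pow]
      exact inv_strictAnti₀ (by positivity) hX
    have h4 : Y⁻¹ ^ M.order ≤ Y⁻¹ ^ (M.mm j l * M.ω l) :=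
      pow_le_pow_of_le_one (by positivity) (inv_le_one_of_one_le₀ hY1) (M.mm_mul_ω_le_order j l)
    have h5 : Y⁻¹ ^ (M.mm j l * M.ω l) ≤ (|y l - x l| / H) ^ (M.mm j l * M.ω l) :=
      pow_le_pow_left₀ (by positivity) h2 _
    linarith
  have hdist : dist y x < ρ := by
    rw [dist_eq_norm]
    calc ‖y - x‖ ≤ ∑ l, |y l - x l| := EuclideanSpace.norm_le_sum_abs _
      _ ≤ ∑ _l : Fin d, ρ' := Finset.sum_le_sum fun l _ => (hcoord l).le
      _ = d * ρ' := by simp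
      _ < (d + 1) * ρ' := by linarith
      _ = ρ := by simp only [ρ']; field_simp
  have hgd : |M.grad y j - M.grad x j| < ε₀ / (2 * R) := by
    have h := hunif y hy1 x hx1 hdist
    rw [dist_eq_norm] at h
    exact (PiLp.norm_apply_le (M.grad y - M.grad x) j).trans_lt h
  have hgx : ε₀ / R ≤ SignType.sign (ξ j) * M.grad x j := by
    have e : SignType.sign (ξ j) * M.grad x j = ‖M.grad x‖ * (|ξ j| / ‖ξ‖) := by
      conv_lhs => rw [M.grad_eq_of_isPointWithNormal hx]
      rw [← sign_mul_self (ξ j)]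
      simp only [PiLp.smul_apply, smul_eq_mul]
      ring
    rw [e, div_eq_inv_mul]
    have := hR x hx1
    gcongr
  have hs : |(SignType.sign (ξ j) : ℝ) * (M.grad y j - M.grad x j)| < ε₀ / (2 * R) := by
    have : |(SignType.sign (ξ j) : ℝ)| ≤ 1 := by
      rcases SignType.sign (ξ j) <;> simp
    rw [abs_mul]
    exact (mul_le_of_le_one_left (abs_nonneg _) this).trans_lt hgd
  have h6 := (abs_lt.mp hs).1
  have h7 : ε₀ / R = ε₀ / (2 * R) + ε₀ / (2 * R) := by field_simp; ring
  rw [mul_sub] at h6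
  linarith

end ModelData

/-! ### The estimate for bounded and for large |ξ| -/

theorem lemma1 (d : ℕ) (hd : 3 ≤ d) (M : ModelData d) (ε₀ : ℝ) (hε₀ : 0 < ε₀) (hε₁ : ε₀ ≤ 1) :
    ∃ C : ℝ, 0 < C ∧ ∀ (j : Fin d) (ξ : EuclideanSpace ℝ (Fin d)), ξ ≠ 0 → ε₀ ≤ |ξ j| / ‖ξ‖ →
      (∃! x, M.IsPointWithNormal ξ x) ∧
      ∀ x, M.IsPointWithNormal ξ x →
        M.surfaceMeasure (M.cap x ‖ξ‖⁻¹) ≤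
          ENNReal.ofReal C * ∏ l ∈ Finset.univ.erase j, M.factor ξ j l := by
  obtain ⟨H, hH1, hH⟩ := M.exists_cap_extent hε₀ hε₁
  obtain ⟨c, X, hc, hX1, hX⟩ := M.exists_grad_ge_on_cap hε₀ hε₁
  obtain ⟨K₁, hK₁0, hK₁⟩ := M.exists_measure_level_le
  obtain ⟨K₂, hK₂0, hK₂⟩ := M.exists_measure_le_of_grad_ge hc
  have hcard : ∀ j : Fin d, (Finset.univ.erase j).card = d - 1 := fun j => by simp
  -- The first term serves |ξ| ≤ X, the second |ξ| > X; the summand 1 makes the constant positive.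
  refine ⟨K₁ * X ^ (d - 1) + K₂ * H ^ (d - 1) + 1, by positivity, fun j ξ hξ hj =>
    ⟨?_, fun x hx => ?_⟩⟩
  · obtain ⟨x, hx⟩ := M.exists_isPointWithNormal hξ
    exact ⟨x, hx, fun y hy => hx.unique M hξ hy⟩
  have hsurf : M.surfaceMeasure (M.cap x ‖ξ‖⁻¹) ≤
      Measure.euclideanHausdorffMeasure (d - 1) (M.cap x ‖ξ‖⁻¹) := Measure.restrict_le_self _
  refine hsurf.trans ?_
  rcases le_or_gt ‖ξ‖ X with h | h
  · have h1 : Measure.euclideanHausdorffMeasure (d - 1) (M.cap x ‖ξ‖⁻¹) ≤ ENNReal.ofReal K₁ :=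
      (measure_mono fun y hy => M.mem_frontier_iff.mp hy.1).trans hK₁
    have h2 : ENNReal.ofReal X⁻¹ ^ (d - 1) ≤ ∏ l ∈ Finset.univ.erase j, M.factor ξ j l := by
      rw [← hcard j, ← Finset.prod_const]
      exact Finset.prod_le_prod' fun l _ => M.le_factor_of_norm_le hξ hX1 h j l
    calc _ ≤ ENNReal.ofReal K₁ := h1
      _ = ENNReal.ofReal (K₁ * X ^ (d - 1)) * ENNReal.ofReal X⁻¹ ^ (d - 1) := by
        rw [← ENNReal.ofReal_pow (by positivity), ← ENNReal.ofReal_mul (by positivity), inv_pow,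
          mul_assoc, mul_inv_cancel₀ (by positivity), mul_one]
      _ ≤ _ := by
        gcongr
        have : 0 ≤ K₂ * H ^ (d - 1) := by positivity
        linarith
  · have hξj : ξ j ≠ 0 := by
      intro h0
      rw [h0, abs_zero, zero_div] at hj
      linarith
    have hs : |((SignType.sign (ξ j) : SignType) : ℝ)| = 1 := by
      rcases lt_or_gt_of_ne hξj with h0 | h0 <;> simp [h0]
    have h1 := hK₂ j (SignType.sign (ξ j)) hs (M.cap x ‖ξ‖⁻¹)
      (fun y hy => ⟨M.mem_frontier_iff.mp hy.1, hX j ξ x y h hj hx hy⟩) x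
      (fun l => ENNReal.ofReal H * M.factor ξ j l) (fun l _ y hy => by
        obtain ⟨e1, e2⟩ := hH j ξ x y hξ hj hx hy l
        have e3 := M.ofReal_le_factor hξ (by positivity) e1 e2
        calc ENNReal.ofReal |y l - x l| = ENNReal.ofReal (H * (|y l - x l| / H)) := by
              rw [mul_div_cancel₀ _ (by positivity)]
          _ = ENNReal.ofReal H * ENNReal.ofReal (|y l - x l| / H) :=
              ENNReal.ofReal_mul (by positivity)
          _ ≤ _ := by gcongr)
    rw [Finset.prod_mul_distrib, Finset.prod_const, hcard, ← mul_assoc,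
      ← ENNReal.ofReal_pow (by positivity), ← ENNReal.ofReal_mul hK₂0] at h1
    refine h1.trans ?_
    gcongr
    have : 0 ≤ K₁ * X ^ (d - 1) := by positivity
    linarith
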